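/- For every real $\varepsilon>0$ there exists a finite simple graph $G$ that is cubic (every vertex has degree $3$) and $3$-connected (it has more than $3$ vertices and deleting any set of at most $2$ vertices leaves a connected graph) such that $\mathrm{tsp}(G)\ge(1.125-\varepsilon)\,|V(G)|$. Here $\mathrm{tsp}(G)$ denotes the length (number of edges, counted with multiplicity) of a shortest travelling salesman tour of $G$, that is, of a shortest closed walk in $G$ that contains all vertices of $G$. -/

import Mathlib

namespace SimpleGraph

/-- `G` is `k`-vertex-connected: it has more than `k` vertices and deleting any set of fewer
than `k` vertices leaves a connected graph. -/
def IsVertexConnected {V : Type*} [Fintype V] (G : SimpleGraph V) (k : ℕ) : Prop :=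
  k < Fintype.card V ∧
    ∀ S : Finset V, S.card < k → (G.induce {v : V | v ∉ S}).Connected

/-- A travelling salesman tour: a closed walk that contains all vertices of the graph. -/
def IsTSPTour {V : Type*} (G : SimpleGraph V) {v : V} (w : G.Walk v v) : Prop :=
  ∀ u : V, u ∈ w.support

/-- The length of a shortest travelling salesman tour of `G`. (For a graph without any tour
the value is `0`; finite connected nonempty graphs always have a tour.) -/
noncomputable def tsp {V : Type*} (G : SimpleGraph V) : ℕ :=
  sInf {l : ℕ | ∃ (v : V) (w : G.Walk v v), G.IsTSPTour w ∧ w.length = l}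

end SimpleGraph

/-! The graph is a ring of `K` cells. Each cell is the Petersen graph minus two adjacent vertices
`8` and `9`; the two links to the previous cell replace the edges at `8`, those to the next cell the
edges at `9`. The ring has `8K` vertices, so it suffices that all but boundedly many cells cost at
least 9.

A closed walk through all vertices yields edge multiplicities for which every cut is even and every
proper cut is nonzero (`exists_isTourWeight_of_isTSPTour`). By an exchange argument
(`IsTourWeight.exists_reduced`) the two links between consecutive cells may be assumed to have total
at most 2.

Contract everything left of a cell to `8` and everything right of it to `9`, and give the edge
`8`-`9` the parity of the left link total. If the result is connected, it is a connected spanning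
Eulerian multigraph in the Petersen graph, so it has at least 11 edges, as that graph has no
Hamiltonian cycle (`petersen_eleven_le`). The left links and the edge `8`-`9` account for at most 2
of them, which leaves 9 for the cell and its right links (`nine_le_of_not_isSeparated`).

Connectedness fails only at a separated cell, whose two sides are not joined through it. Two
separated cells that are not neighbours would disconnect the whole tour
(`IsSeparated.mem_of_isSeparated`), so at most three cells are lost.

3-connectivity is proved through 2-colourings that are constant along the surviving edges
(`ring_colouring_eq`). -/

/-! ### Tour weights on multigraphs -/

section TourWeights

variable {V E : Type*} [Fintype E]

/-- The total weight of the edges that join the two classes of the 2-colouring `χ`. The edge `e`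
joins `s e` to `t e`. -/
def cutWeight (s t : E → V) (m : E → ℕ) (χ : V → Bool) : ℕ :=
  ∑ e, if χ (s e) ≠ χ (t e) then m e else 0

/-- Edge multiplicities of a connected spanning Eulerian multigraph, described by cuts. -/
def IsTourWeight (s t : E → V) (m : E → ℕ) : Prop :=
  ∀ χ : V → Bool, Even (cutWeight s t m χ) ∧ (cutWeight s t m χ = 0 → ∀ x y, χ x = χ y)

lemma cutWeight_eq_zero_iff {s t : E → V} {m : E → ℕ} {χ : V → Bool} :
    cutWeight s t m χ = 0 ↔ ∀ e, χ (s e) ≠ χ (t e) → m e = 0 := by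
  simp [cutWeight, Finset.sum_eq_zero_iff]

lemma cutWeight_add (s t : E → V) (m m' : E → ℕ) (χ : V → Bool) :
    cutWeight s t (m + m') χ = cutWeight s t m χ + cutWeight s t m' χ := by
  simp only [cutWeight, ← Finset.sum_add_distrib]
  refine Finset.sum_congr rfl fun e _ => ?_
  split_ifs <;> simp

lemma cutWeight_single [DecidableEq E] (s t : E → V) (e : E) (n : ℕ) (χ : V → Bool) :
    cutWeight s t (Pi.single e n) χ = if χ (s e) ≠ χ (t e) then n else 0 := by
  unfold cutWeight
  rw [Finset.sum_eq_single e]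
  · simp
  · intro b _ hb
    simp [Pi.single_eq_of_ne hb]
  · simp

/-- A walk induces edge multiplicities. -/
lemma exists_weight_of_walk [DecidableEq E] {G : SimpleGraph V} {s t : E → V}
    (hG : ∀ x y, G.Adj x y → ∃ e, (s e = x ∧ t e = y) ∨ (s e = y ∧ t e = x))
    {u v : V} (w : G.Walk u v) :
    ∃ m : E → ℕ, ∑ e, m e = w.length ∧
      (∀ χ : V → Bool, Even (cutWeight s t m χ) ↔ χ u = χ v) ∧
      (∀ χ : V → Bool, cutWeight s t m χ = 0 → ∀ x ∈ w.support, χ x = χ u) := by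
  induction w with
  | nil => exact ⟨0, by simp, fun χ => by simp [cutWeight], fun χ _ x hx => by simp_all⟩
  | @cons u v' v h p ih =>
    obtain ⟨m, h1, h2, h3⟩ := ih
    obtain ⟨e, he⟩ := hG _ _ h
    have hχ : ∀ χ : V → Bool, (χ (s e) ≠ χ (t e)) ↔ χ u ≠ χ v' := by
      intro χ
      rcases he with ⟨rfl, rfl⟩ | ⟨rfl, rfl⟩
      · rfl
      · exact ne_comm
    refine ⟨m + Pi.single e 1, ?_, fun χ => ?_, fun χ => ?_⟩
    · simp [Finset.sum_add_distrib, h1]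
    · rw [cutWeight_add, cutWeight_single, Nat.even_add, h2]
      simp only [hχ]
      cases χ u <;> cases χ v' <;> cases χ v <;> simp
    · rw [cutWeight_add, cutWeight_single]
      simp only [hχ]
      intro h0 x hx
      have h4 := h3 χ (by omega)
      have h5 : χ u = χ v' := by
        by_contra hne
        simp [hne] at h0
      rw [SimpleGraph.Walk.support_cons, List.mem_cons] at hx
      rcases hx with rfl | hx
      · rfl
      · rw [h4 x hx, h5]

lemma exists_isTourWeight_of_isTSPTour [DecidableEq E] {G : SimpleGraph V} {s t : E → V}
    (hG : ∀ x y, G.Adj x y → ∃ e, (s e = x ∧ t e = y) ∨ (s e = y ∧ t e = x))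
    {v : V} {w : G.Walk v v} (hw : G.IsTSPTour w) :
    ∃ m : E → ℕ, ∑ e, m e = w.length ∧ IsTourWeight s t m := by
  obtain ⟨m, h1, h2, h3⟩ := exists_weight_of_walk hG w
  exact ⟨m, h1, fun χ => ⟨(h2 χ).2 rfl, fun h0 x y =>
    (h3 χ h0 x (hw x)).trans (h3 χ h0 y (hw y)).symm⟩⟩

/-- Exchange argument: a tour weight can be changed, without increasing its total, so that every
edge of `B` with weight at least two has weight two and is the only edge of positive weight in a
cut that consists of edges of `B`. -/
lemma IsTourWeight.exists_reduced [DecidableEq E] {s t : E → V} {m₀ : E → ℕ}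
    (h₀ : IsTourWeight s t m₀) (B : Finset E) :
    ∃ m : E → ℕ, IsTourWeight s t m ∧ ∑ e, m e ≤ ∑ e, m₀ e ∧
      ∀ e ∈ B, 2 ≤ m e → m e = 2 ∧ ∃ χ : V → Bool, χ (s e) ≠ χ (t e) ∧
        ∀ f, f ≠ e → χ (s f) ≠ χ (t f) → m f = 0 ∧ f ∈ B := by
  -- Edges of `B` count twice: the measure drops when two copies of an edge are removed, and also
  -- when they are moved from `B` to an edge outside `B`.
  obtain ⟨m, ⟨hm, hle⟩, hmin⟩ := WellFounded.has_min
    (InvImage.wf (fun m : E → ℕ => ∑ e, m e + ∑ e ∈ B, m e) Nat.lt_wfRel.wf)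
    {m | IsTourWeight s t m ∧ ∑ e, m e ≤ ∑ e, m₀ e} ⟨m₀, h₀, le_rfl⟩
  refine ⟨m, hm, hle, fun e he h2 => ?_⟩
  obtain ⟨m', hm'⟩ : ∃ m' : E → ℕ, m = m' + Pi.single e 2 := by
    refine ⟨fun f => m f - (Pi.single e 2 : E → ℕ) f, ?_⟩
    funext f
    by_cases hf : f = e
    · subst hf
      simp
      omega
    · simp [Pi.single_eq_of_ne hf]
  have hcut : ∀ χ, cutWeight s t m χ =
      cutWeight s t m' χ + if χ (s e) ≠ χ (t e) then 2 else 0 := by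
    intro χ
    rw [hm', cutWeight_add, cutWeight_single]
  have hsum : ∑ f, m f = ∑ f, m' f + 2 := by
    rw [hm']
    simp [Finset.sum_add_distrib]
  have hsumB : ∑ f ∈ B, m f = ∑ f ∈ B, m' f + 2 := by
    rw [hm']
    simp [Finset.sum_add_distrib, he]
  have heven : ∀ χ, Even (cutWeight s t m' χ) := by
    intro χ
    have h1 := (hm χ).1
    rw [hcut, Nat.even_add] at h1
    apply h1.2
    split_ifs <;> decide
  -- Removing two copies of `e` preserves all parities, so by minimality it must destroy
  -- connectedness.
  have hnot : ¬ IsTourWeight s t m' := by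
    intro h
    apply hmin m' ⟨h, by omega⟩
    change ∑ f, m' f + ∑ f ∈ B, m' f < ∑ f, m f + ∑ f ∈ B, m f
    omega
  obtain ⟨χ, hχ0, x, y, hxy⟩ : ∃ χ : V → Bool, cutWeight s t m' χ = 0 ∧ ∃ x y, χ x ≠ χ y := by
    by_contra hcon
    apply hnot
    intro χ
    refine ⟨heven χ, fun h0 x y => ?_⟩
    by_contra hne
    exact hcon ⟨χ, h0, x, y, hne⟩
  have cross : ∀ ψ : V → Bool, cutWeight s t m' ψ = 0 → (∃ x y, ψ x ≠ ψ y) →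
      ψ (s e) ≠ ψ (t e) := by
    rintro ψ h0 ⟨x, y, hne⟩ heq
    refine hne ((hm ψ).2 ?_ x y)
    rw [hcut, h0]
    simp [heq]
  have hχe := cross χ hχ0 ⟨x, y, hxy⟩
  have hz := cutWeight_eq_zero_iff.1 hχ0
  refine ⟨?_, χ, hχe, fun f hf hfχ => ⟨?_, ?_⟩⟩
  · rw [hm']
    simp [hz e hχe]
  · rw [hm']
    simp [hz f hfχ, Pi.single_eq_of_ne hf]
  · by_contra hfB
    -- Swapping the two copies of `e` for two copies of `f` would reconnect the two sides at the
    -- same total and with less weight on `B`.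
    have htour : IsTourWeight s t (m' + Pi.single f 2) := by
      intro ψ
      rw [cutWeight_add, cutWeight_single]
      constructor
      · refine (heven ψ).add ?_
        split_ifs <;> decide
      · intro h0
        by_contra hne
        push Not at hne
        have h0' : cutWeight s t m' ψ = 0 := by omega
        have hψe := cross ψ h0' hne
        -- `χ` and `ψ` both separate the ends of `e`, so their sum does not and is a zero cut of
        -- `m`. It is therefore constant, and `ψ` separates the ends of `f` as `χ` does.
        have hconst := (hm (fun v => xor (χ v) (ψ v))).2 (by
          rw [cutWeight_eq_zero_iff]
          intro g hg
          by_cases hge : g = e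
          · subst hge
            exfalso
            revert hg hχe hψe
            cases χ (s g) <;> cases χ (t g) <;> cases ψ (s g) <;> cases ψ (t g) <;> simp
          · have : m' g = 0 := by
              by_cases hgχ : χ (s g) = χ (t g)
              · refine cutWeight_eq_zero_iff.1 h0' g fun hgψ => hg ?_
                simp [hgχ, hgψ]
              · exact hz g hgχ
            rw [hm']
            simp [this, Pi.single_eq_of_ne hge]) (s f) (t f)
        have hψf : ψ (s f) ≠ ψ (t f) := by
          revert hconst hfχ
          cases χ (s f) <;> cases χ (t f) <;> cases ψ (s f) <;> cases ψ (t f) <;> simp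
        simp [hψf] at h0
    apply hmin _ ⟨htour, ?_⟩
    · change ∑ g, (m' g + (Pi.single f 2 : E → ℕ) g) +
        ∑ g ∈ B, (m' g + (Pi.single f 2 : E → ℕ) g) < ∑ g, m g + ∑ g ∈ B, m g
      simp [Finset.sum_add_distrib, hfB]
      omega
    · simp [Finset.sum_add_distrib]
      omega

end TourWeights

/-! ### The Petersen graph -/

/-- First ends of the edges of the Petersen graph on `Fin 10`; the last edge joins `8` and `9`. -/
def petersenSrc : Fin 15 → Fin 10 := ![0, 1, 2, 4, 5, 6, 0, 1, 2, 3, 8, 8, 4, 7, 8]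

/-- Second ends of the edges of the Petersen graph on `Fin 10`. -/
def petersenDst : Fin 15 → Fin 10 := ![1, 2, 3, 5, 6, 7, 6, 4, 7, 5, 0, 3, 9, 9, 9]

lemma petersen_cutWeight (w : Fin 15 → ℕ) (χ : Fin 10 → Bool) :
    cutWeight petersenSrc petersenDst w χ =
      (if χ 0 ≠ χ 1 then w 0 else 0) + (if χ 1 ≠ χ 2 then w 1 else 0) +
      (if χ 2 ≠ χ 3 then w 2 else 0) + (if χ 4 ≠ χ 5 then w 3 else 0) +
      (if χ 5 ≠ χ 6 then w 4 else 0) + (if χ 6 ≠ χ 7 then w 5 else 0) +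
      (if χ 0 ≠ χ 6 then w 6 else 0) + (if χ 1 ≠ χ 4 then w 7 else 0) +
      (if χ 2 ≠ χ 7 then w 8 else 0) + (if χ 3 ≠ χ 5 then w 9 else 0) +
      (if χ 8 ≠ χ 0 then w 10 else 0) + (if χ 8 ≠ χ 3 then w 11 else 0) +
      (if χ 4 ≠ χ 9 then w 12 else 0) + (if χ 7 ≠ χ 9 then w 13 else 0) +
      (if χ 8 ≠ χ 9 then w 14 else 0) := by
  simp only [cutWeight, Fin.sum_univ_castSucc, Finset.univ_eq_empty, Finset.sum_empty, zero_add]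
  rfl

/-- With total at most 10, the degree sum forces every degree to be 2. By the cuts `p` around pairs
of adjacent vertices no edge has weight 2, so the edges of weight 0 form a perfect matching. The
hypotheses `c` forbid this for each of the six perfect matchings, whose complements are pairs of
5-cycles. -/
lemma petersen_weights_eleven_le (x0 x1 x2 x3 x4 x5 x6 x7 x8 x9 x10 x11 x12 x13 x14 : ℕ)
    (d0 : 2 ≤ x0 + x6 + x10)
    (d1 : 2 ≤ x0 + x1 + x7)
    (d2 : 2 ≤ x1 + x2 + x8)
    (d3 : 2 ≤ x2 + x9 + x11)
    (d4 : 2 ≤ x3 + x7 + x12)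
    (d5 : 2 ≤ x3 + x4 + x9)
    (d6 : 2 ≤ x4 + x5 + x6)
    (d7 : 2 ≤ x5 + x8 + x13)
    (d8 : 2 ≤ x10 + x11 + x14)
    (d9 : 2 ≤ x12 + x13 + x14)
    (p0 : 0 < x1 + x6 + x7 + x10)
    (p1 : 0 < x0 + x2 + x7 + x8)
    (p2 : 0 < x1 + x8 + x9 + x11)
    (p3 : 0 < x4 + x7 + x9 + x12)
    (p4 : 0 < x3 + x5 + x6 + x9)
    (p5 : 0 < x4 + x6 + x8 + x13)
    (p6 : 0 < x0 + x4 + x5 + x10)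
    (p7 : 0 < x0 + x1 + x3 + x12)
    (p8 : 0 < x1 + x2 + x5 + x13)
    (p9 : 0 < x2 + x3 + x4 + x11)
    (p10 : 0 < x0 + x6 + x11 + x14)
    (p11 : 0 < x2 + x9 + x10 + x14)
    (p12 : 0 < x3 + x7 + x13 + x14)
    (p13 : 0 < x5 + x8 + x12 + x14)
    (p14 : 0 < x10 + x11 + x12 + x13)
    (c0 : 0 < x0 + x2 + x3 + x5 + x14)
    (c1 : 0 < x0 + x4 + x8 + x11 + x12)
    (c2 : 0 < x1 + x3 + x6 + x11 + x13)
    (c3 : 0 < x1 + x5 + x9 + x10 + x12)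
    (c4 : 0 < x2 + x4 + x7 + x10 + x13)
    (c5 : 0 < x6 + x7 + x8 + x9 + x14) :
    11 ≤ x0 + x1 + x2 + x3 + x4 + x5 + x6 + x7 + x8 + x9 + x10 + x11 + x12 + x13 + x14 := by
  by_contra! hlt
  have e0 : x0 + x6 + x10 = 2 :=
    le_antisymm (by linarith only [hlt, d1, d2, d3, d4, d5, d6, d7, d8, d9]) d0
  have e1 : x0 + x1 + x7 = 2 :=
    le_antisymm (by linarith only [hlt, d0, d2, d3, d4, d5, d6, d7, d8, d9]) d1
  have e2 : x1 + x2 + x8 = 2 :=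
    le_antisymm (by linarith only [hlt, d0, d1, d3, d4, d5, d6, d7, d8, d9]) d2
  have e3 : x2 + x9 + x11 = 2 :=
    le_antisymm (by linarith only [hlt, d0, d1, d2, d4, d5, d6, d7, d8, d9]) d3
  have e4 : x3 + x7 + x12 = 2 :=
    le_antisymm (by linarith only [hlt, d0, d1, d2, d3, d5, d6, d7, d8, d9]) d4
  have e5 : x3 + x4 + x9 = 2 :=
    le_antisymm (by linarith only [hlt, d0, d1, d2, d3, d4, d6, d7, d8, d9]) d5
  have e6 : x4 + x5 + x6 = 2 :=
    le_antisymm (by linarith only [hlt, d0, d1, d2, d3, d4, d5, d7, d8, d9]) d6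
  have e7 : x5 + x8 + x13 = 2 :=
    le_antisymm (by linarith only [hlt, d0, d1, d2, d3, d4, d5, d6, d8, d9]) d7
  have e8 : x10 + x11 + x14 = 2 :=
    le_antisymm (by linarith only [hlt, d0, d1, d2, d3, d4, d5, d6, d7, d9]) d8
  have e9 : x12 + x13 + x14 = 2 :=
    le_antisymm (by linarith only [hlt, d0, d1, d2, d3, d4, d5, d6, d7, d8]) d9
  clear d0 d1 d2 d3 d4 d5 d6 d7 d8 d9 hlt
  have aux : ∀ a b c d e : ℕ, 0 < b + c + d + e → a + b + c = 2 → a + d + e = 2 → a ≤ 1 := by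
    omega
  have l0 : x0 ≤ 1 :=
    aux _ x6 x10 x1 x7 (by linarith only [p0])
      (by linarith only [e0]) (by linarith only [e1])
  have l1 : x1 ≤ 1 :=
    aux _ x0 x7 x2 x8 (by linarith only [p1])
      (by linarith only [e1]) (by linarith only [e2])
  have l2 : x2 ≤ 1 :=
    aux _ x1 x8 x9 x11 (by linarith only [p2])
      (by linarith only [e2]) (by linarith only [e3])
  have l3 : x3 ≤ 1 :=
    aux _ x7 x12 x4 x9 (by linarith only [p3])
      (by linarith only [e4]) (by linarith only [e5])
  have l4 : x4 ≤ 1 :=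
    aux _ x3 x9 x5 x6 (by linarith only [p4])
      (by linarith only [e5]) (by linarith only [e6])
  have l5 : x5 ≤ 1 :=
    aux _ x4 x6 x8 x13 (by linarith only [p5])
      (by linarith only [e6]) (by linarith only [e7])
  have l6 : x6 ≤ 1 :=
    aux _ x0 x10 x4 x5 (by linarith only [p6])
      (by linarith only [e0]) (by linarith only [e6])
  have l7 : x7 ≤ 1 :=
    aux _ x0 x1 x3 x12 (by linarith only [p7])
      (by linarith only [e1]) (by linarith only [e4])
  have l8 : x8 ≤ 1 :=
    aux _ x1 x2 x5 x13 (by linarith only [p8])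
      (by linarith only [e2]) (by linarith only [e7])
  have l9 : x9 ≤ 1 :=
    aux _ x2 x11 x3 x4 (by linarith only [p9])
      (by linarith only [e3]) (by linarith only [e5])
  have l10 : x10 ≤ 1 :=
    aux _ x11 x14 x0 x6 (by linarith only [p10])
      (by linarith only [e8]) (by linarith only [e0])
  have l11 : x11 ≤ 1 :=
    aux _ x10 x14 x2 x9 (by linarith only [p11])
      (by linarith only [e8]) (by linarith only [e3])
  have l12 : x12 ≤ 1 :=
    aux _ x3 x7 x13 x14 (by linarith only [p12])
      (by linarith only [e4]) (by linarith only [e9])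
  have l13 : x13 ≤ 1 :=
    aux _ x5 x8 x12 x14 (by linarith only [p13])
      (by linarith only [e7]) (by linarith only [e9])
  have l14 : x14 ≤ 1 :=
    aux _ x10 x11 x12 x13 (by linarith only [p14])
      (by linarith only [e8]) (by linarith only [e9])
  clear p0 p1 p2 p3 p4 p5 p6 p7 p8 p9 p10 p11 p12 p13 p14 aux
  have two : ∀ a : ℕ, a ≤ 1 → a = 0 ∨ a = 1 := by omega
  -- These five edges suffice for the case split: the degree equations and the matching conditions
  -- refute every case.
  rcases two _ l14 with rfl | rfl <;> rcases two _ l10 with rfl | rfl <;>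
    rcases two _ l12 with rfl | rfl <;> rcases two _ l0 with rfl | rfl <;>
    rcases two _ l3 with rfl | rfl <;> omega

/-- A spanning connected Eulerian multigraph in the Petersen graph has at least eleven edges. -/
theorem petersen_eleven_le (w : Fin 15 → ℕ)
    (heven : ∀ v, Even (cutWeight petersenSrc petersenDst w fun x => decide (x = v)))
    (hconn : ∀ χ, cutWeight petersenSrc petersenDst w χ = 0 → ∀ x y, χ x = χ y) :
    11 ≤ ∑ e, w e := by
  have pos : ∀ (χ : Fin 10 → Bool) (x y : Fin 10), χ x ≠ χ y →
      0 < cutWeight petersenSrc petersenDst w χ := fun χ x y h =>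
    Nat.pos_of_ne_zero fun h0 => h (hconn χ h0 x y)
  have two : ∀ v, 2 ≤ cutWeight petersenSrc petersenDst w fun x => decide (x = v) := by
    intro v
    have h1 := pos (fun x => decide (x = v)) v (v + 1) (by
      revert v; decide)
    obtain ⟨k, hk⟩ := heven v
    omega
  clear heven hconn
  simp only [petersen_cutWeight] at pos two
  simp only [Fin.sum_univ_castSucc, Finset.univ_eq_empty, Finset.sum_empty, zero_add]
  have d0 := two 0
  have d1 := two 1
  have d2 := two 2
  have d3 := two 3
  have d4 := two 4
  have d5 := two 5
  have d6 := two 6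
  have d7 := two 7
  have d8 := two 8
  have d9 := two 9
  have p0 := pos (fun x => decide (x = 0 ∨ x = 1)) 0 2 (by decide)
  have p1 := pos (fun x => decide (x = 1 ∨ x = 2)) 1 0 (by decide)
  have p2 := pos (fun x => decide (x = 2 ∨ x = 3)) 2 0 (by decide)
  have p3 := pos (fun x => decide (x = 4 ∨ x = 5)) 4 0 (by decide)
  have p4 := pos (fun x => decide (x = 5 ∨ x = 6)) 5 0 (by decide)
  have p5 := pos (fun x => decide (x = 6 ∨ x = 7)) 6 0 (by decide)
  have p6 := pos (fun x => decide (x = 0 ∨ x = 6)) 0 1 (by decide)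
  have p7 := pos (fun x => decide (x = 1 ∨ x = 4)) 1 0 (by decide)
  have p8 := pos (fun x => decide (x = 2 ∨ x = 7)) 2 0 (by decide)
  have p9 := pos (fun x => decide (x = 3 ∨ x = 5)) 3 0 (by decide)
  have p10 := pos (fun x => decide (x = 0 ∨ x = 8)) 0 1 (by decide)
  have p11 := pos (fun x => decide (x = 3 ∨ x = 8)) 3 0 (by decide)
  have p12 := pos (fun x => decide (x = 4 ∨ x = 9)) 4 0 (by decide)
  have p13 := pos (fun x => decide (x = 7 ∨ x = 9)) 7 0 (by decide)
  have p14 := pos (fun x => decide (x = 8 ∨ x = 9)) 8 0 (by decide)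
  -- Each of the six cuts has a 5-cycle on either side and consists of a perfect matching.
  have c0 := pos (fun x => decide (x = 0 ∨ x = 3 ∨ x = 5 ∨ x = 6 ∨ x = 8)) 0 1 (by decide)
  have c1 := pos (fun x => decide (x = 0 ∨ x = 6 ∨ x = 7 ∨ x = 8 ∨ x = 9)) 0 1 (by decide)
  have c2 := pos (fun x => decide (x = 0 ∨ x = 1 ∨ x = 4 ∨ x = 8 ∨ x = 9)) 0 2 (by decide)
  have c3 := pos (fun x => decide (x = 2 ∨ x = 3 ∨ x = 7 ∨ x = 8 ∨ x = 9)) 2 0 (by decide)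
  have c4 := pos (fun x => decide (x = 3 ∨ x = 4 ∨ x = 5 ∨ x = 8 ∨ x = 9)) 3 0 (by decide)
  have c5 := pos (fun x => decide (x = 0 ∨ x = 1 ∨ x = 2 ∨ x = 3 ∨ x = 8)) 0 4 (by decide)
  clear two pos
  simp +decide only [if_true, if_false, add_zero, zero_add] at d0 d1 d2 d3 d4 d5 d6 d7 d8 d9
  simp +decide only [if_true, if_false, add_zero, zero_add] at p0 p1 p2 p3 p4 p5 p6 p7 p8
  simp +decide only [if_true, if_false, add_zero, zero_add] at p9 p10 p11 p12 p13 p14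
  simp +decide only [if_true, if_false, add_zero, zero_add] at c0 c1 c2 c3 c4 c5
  exact petersen_weights_eleven_le (w 0) (w 1) (w 2) (w 3) (w 4) (w 5) (w 6) (w 7) (w 8) (w 9)
    (w 10) (w 11) (w 12) (w 13) (w 14) d0 d1 d2 d3 d4 d5 d6 d7 d8 d9
    p0 p1 p2 p3 p4 p5 p6 p7 p8 p9 p10 p11 p12 p13 p14 c0 c1 c2 c3 c4 c5

/-! ### A ring of Petersen fragments -/

section Ring

/-- Labels of the first ends of the edges of one cell; the last two edges lead to the next cell. -/
def cellSrc : Fin 12 → Fin 8 := ![0, 1, 2, 4, 5, 6, 0, 1, 2, 3, 4, 7]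

/-- Labels of the second ends of the edges of one cell. -/
def cellDst : Fin 12 → Fin 8 := ![1, 2, 3, 5, 6, 7, 6, 4, 7, 5, 0, 3]

/-- First end of an edge of the ring. -/
def ringSrc (K : ℕ) (e : ZMod K × Fin 12) : ZMod K × Fin 8 := (e.1, cellSrc e.2)

/-- Second end of an edge of the ring. -/
def ringDst (K : ℕ) (e : ZMod K × Fin 12) : ZMod K × Fin 8 :=
  (if e.2 < 10 then e.1 else e.1 + 1, cellDst e.2)

variable {K : ℕ}

/-- The weights on the Petersen graph obtained from the ring by contracting everything on the left
of the cell `c` to the vertex `8` and everything on its right to `9`, with weight `n` on the edge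
between these. -/
def cellWeight (m : ZMod K × Fin 12 → ℕ) (c : ZMod K) (n : ℕ) : Fin 15 → ℕ :=
  ![m (c, 0), m (c, 1), m (c, 2), m (c, 3), m (c, 4), m (c, 5), m (c, 6), m (c, 7), m (c, 8),
    m (c, 9), m (c - 1, 10), m (c - 1, 11), m (c, 10), m (c, 11), n]

/-- The weights `m` do not connect the left side of the cell `c` to its right side within `c`. -/
def IsSeparated (m : ZMod K × Fin 12 → ℕ) (c : ZMod K) : Prop :=
  ∃ χ : Fin 10 → Bool, χ 8 = false ∧ χ 9 = true ∧
    cutWeight petersenSrc petersenDst (cellWeight m c 0) χ = 0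

lemma cutWeight_not {V E : Type*} [Fintype E] (s t : E → V) (m : E → ℕ) (χ : V → Bool) :
    cutWeight s t m (fun x => !χ x) = cutWeight s t m χ := by
  simp [cutWeight]

/-- Outside `c` the colouring is constant, so only the edges in `c` and the links at its two sides
can be cut. The value `n` is arbitrary because the edge `8`-`9` is not cut. -/
lemma cutWeight_cell [NeZero K] [Fact (1 < K)] (m : ZMod K × Fin 12 → ℕ) (c : ZMod K) (n : ℕ)
    (χ : Fin 10 → Bool) (h : χ 8 = χ 9) :
    cutWeight (ringSrc K) (ringDst K) m
        (fun x => if x.1 = c then χ (Fin.castLE (by decide) x.2) else χ 8) =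
      cutWeight petersenSrc petersenDst (cellWeight m c n) χ := by
  have h1 : c - 1 ≠ c := by simp
  have h2 : c + 1 ≠ c := by simp
  rw [petersen_cutWeight]
  unfold cutWeight
  rw [Fintype.sum_prod_type, Finset.sum_eq_add c (c - 1) h1.symm]
  · simp only [Fin.sum_univ_castSucc, Finset.univ_eq_empty, Finset.sum_empty, zero_add, ringSrc,
      ringDst]
    simp [h1, h2, h, cellSrc, cellDst, cellWeight, -ne_eq, Fin.last, Fin.castLE]
    ring
  · intro c' _ hc'
    refine Finset.sum_eq_zero fun j _ => if_neg ?_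
    have h3 : c' + 1 ≠ c := fun h => hc'.2 (by rw [← h]; ring)
    simp only [ringSrc, ringDst]
    by_cases hj : j < 10 <;> simp [hj, hc'.1, h3]
  · simp
  · simp

lemma ring_val_add_one [Fact (1 < K)] (x : ZMod K) :
    (x.val = K - 1 ∧ (x + 1).val = 0) ∨ (x.val < K - 1 ∧ (x + 1).val = x.val + 1) := by
  have hK : 1 < K := Fact.out
  have : NeZero K := ⟨by omega⟩
  have h1 := x.val_lt
  rw [ZMod.val_add, ZMod.val_one]
  by_cases h : x.val = K - 1
  · left
    refine ⟨h, ?_⟩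
    rw [h, Nat.sub_add_cancel hK.le, Nat.mod_self]
  · right
    exact ⟨by omega, Nat.mod_eq_of_lt (by omega)⟩

lemma nine_le_of_not_isSeparated [NeZero K] [Fact (1 < K)] {m : ZMod K × Fin 12 → ℕ}
    (hm : IsTourWeight (ringSrc K) (ringDst K) m) (c : ZMod K)
    (hL : m (c - 1, 10) + m (c - 1, 11) ≤ 2) (hsep : ¬ IsSeparated m c) :
    9 ≤ ∑ j, m (c, j) := by
  set n := (m (c - 1, 10) + m (c - 1, 11)) % 2 with hn
  have key : 11 ≤ ∑ e, cellWeight m c n e := by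
    refine petersen_eleven_le _ (fun v => ?_) (fun χ h0 => ?_)
    · have hLR := cutWeight_cell m c n (fun x => decide (x < 8)) rfl ▸ (hm _).1
      rw [petersen_cutWeight] at hLR
      simp +decide only [cellWeight, if_true, if_false, add_zero, zero_add] at hLR
      change Even (m (c - 1, 10) + m (c - 1, 11) + m (c, 10) + m (c, 11)) at hLR
      by_cases hv8 : v = 8
      · subst hv8
        rw [petersen_cutWeight]
        simp +decide only [cellWeight, if_true, if_false, add_zero, zero_add]
        change Even (m (c - 1, 10) + m (c - 1, 11) + n)
        grind
      by_cases hv9 : v = 9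
      · subst hv9
        rw [petersen_cutWeight]
        simp +decide only [cellWeight, if_true, if_false, add_zero, zero_add]
        change Even (m (c, 10) + m (c, 11) + n)
        grind
      · rw [← cutWeight_cell m c n _ (by simp [Ne.symm hv8, Ne.symm hv9])]
        exact (hm _).1
    · by_cases h89 : χ 8 = χ 9
      · rw [← cutWeight_cell m c n χ h89] at h0
        have hc := (hm _).2 h0
        have h8 : ∀ x, χ x = χ 8 := by
          intro x
          by_cases hx : (x : ℕ) < 8
          · have := hc (c, ⟨x, hx⟩) (c + 1, 0)
            simpa using this
          · have : x = 8 ∨ x = 9 := by omega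
            rcases this with rfl | rfl
            · rfl
            · exact h89.symm
        intro x y
        rw [h8 x, h8 y]
      -- A zero cut between `8` and `9` forces `n = 0`; up to complement it then witnesses that `c`
      -- is separated.
      · exfalso
        have hn0 : n = 0 := by
          rw [petersen_cutWeight] at h0
          simp only [h89, ne_eq, not_false_eq_true, if_true] at h0
          change _ + n = 0 at h0
          omega
        rw [hn0] at h0
        cases h8 : χ 8 with
        | false =>
          exact hsep ⟨χ, h8, by simpa [h8] using h89, h0⟩
        | true =>
          refine hsep ⟨fun x => !χ x, by simp [h8], ?_, by rwa [cutWeight_not]⟩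
          simpa [h8] using h89
  simp only [Fin.sum_univ_castSucc, Finset.univ_eq_empty, Finset.sum_empty, zero_add] at key ⊢
  change 11 ≤ m (c, 0) + m (c, 1) + m (c, 2) + m (c, 3) + m (c, 4) + m (c, 5) + m (c, 6) +
    m (c, 7) + m (c, 8) + m (c, 9) + m (c - 1, 10) + m (c - 1, 11) + m (c, 10) + m (c, 11) + n
    at key
  change 9 ≤ m (c, 0) + m (c, 1) + m (c, 2) + m (c, 3) + m (c, 4) + m (c, 5) + m (c, 6) +
    m (c, 7) + m (c, 8) + m (c, 9) + m (c, 10) + m (c, 11)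
  -- A left link total of 0, 1 or 2 plus its parity `n` is at most 2, and 11 - 2 = 9.
  omega

lemma weight_eq_zero_of_cellWeight {m : ZMod K × Fin 12 → ℕ} {c : ZMod K} {χ : Fin 10 → Bool}
    (h : ∀ e, χ (petersenSrc e) ≠ χ (petersenDst e) → cellWeight m c 0 e = 0) (e : Fin 12)
    (he : e < 10)
    (hχ : χ (Fin.castLE (by decide) (cellSrc e)) ≠ χ (Fin.castLE (by decide) (cellDst e))) :
    m (c, e) = 0 := by
  have h' := h (Fin.castLE (by decide) e)
  fin_cases e
  iterate 10 exact h' hχ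
  all_goals exact absurd he (by decide)

/-- Two separated cells cut the ring into two arcs with no weight between them; if the cells are not
neighbours, both arcs contain a whole cell. Neighbours must be allowed: if the links between them
have weight zero, these alone can separate both. -/
lemma IsSeparated.mem_of_isSeparated [NeZero K] [Fact (1 < K)] {m : ZMod K × Fin 12 → ℕ}
    (hm : IsTourWeight (ringSrc K) (ringDst K) m) {i j : ZMod K} (hi : IsSeparated m i)
    (hj : IsSeparated m j) : j ∈ ({i, i + 1, i - 1} : Finset (ZMod K)) := by
  obtain ⟨χ, hχ8, hχ9, hχ⟩ := hi
  obtain ⟨ψ, hψ8, hψ9, hψ⟩ := hj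
  rw [cutWeight_eq_zero_iff] at hχ hψ
  have hK : 1 < K := Fact.out
  by_contra hmem
  simp only [Finset.mem_insert, Finset.mem_singleton, not_or] at hmem
  obtain ⟨hji, hji1, hji2⟩ := hmem
  have val_eq : ∀ x y : ZMod K, (x - i).val = (y - i).val → x = y := fun x y h =>
    sub_left_injective (ZMod.val_injective K h)
  obtain ⟨N, hN⟩ : ∃ N, N = (j - i).val := ⟨_, rfl⟩
  have hNK : N < K := hN ▸ ZMod.val_lt _
  have hii : (i - i).val = 0 := by simp
  have hN0 : N ≠ 0 := fun h => hji (val_eq _ _ (by omega))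
  have step : ∀ c : ZMod K, ((c - i).val = K - 1 ∧ (c + 1 - i).val = 0) ∨
      ((c - i).val < K - 1 ∧ (c + 1 - i).val = (c - i).val + 1) := by
    intro c
    have := ring_val_add_one (c - i)
    rwa [sub_add_eq_add_sub] at this
  have hN1 : N ≠ 1 := by
    intro h
    refine hji1 (val_eq _ _ ?_)
    have := step i
    omega
  have hNK1 : N ≠ K - 1 := by
    intro h
    refine hji2 (val_eq _ _ ?_)
    have := step (i - 1)
    rw [sub_add_cancel] at this
    omega
  -- Positions are measured from `i`, with `j` at `N`. The colouring is true strictly between the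
  -- two cells, false beyond `j`, and interpolates by `χ` in `i` and by the complement of `ψ` in
  -- `j`.
  let X : ZMod K × Fin 8 → Bool := fun x =>
    if (x.1 - i).val = 0 then χ (Fin.castLE (by decide) x.2)
    else if (x.1 - i).val < N then true
    else if (x.1 - i).val = N then !ψ (Fin.castLE (by decide) x.2)
    else false
  have hX0 : cutWeight (ringSrc K) (ringDst K) m X = 0 := by
    rw [cutWeight_eq_zero_iff]
    have hXi : ∀ v, X (i, v) = χ (Fin.castLE (by decide) v) := fun v => by
      simp only [X, hii, if_true]
    have hXj : ∀ v, X (j, v) = !ψ (Fin.castLE (by decide) v) := fun v => by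
      simp only [X, ← hN, if_neg hN0, lt_irrefl, if_false, if_true]
    have hXt : ∀ c v, (c - i).val ≠ 0 → (c - i).val < N → X (c, v) = true := fun c v h0 h1 => by
      simp only [X, if_neg h0, if_pos h1]
    have hXf : ∀ c v, N < (c - i).val → X (c, v) = false := fun c v h1 => by
      simp only [X, if_neg (show (c - i).val ≠ 0 by omega), if_neg h1.not_gt, if_neg h1.ne']
    have hlinks : ∀ c, (X (c, 4) ≠ X (c + 1, 0) → m (c, 10) = 0) ∧
        (X (c, 7) ≠ X (c + 1, 3) → m (c, 11) = 0) := by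
      intro c
      have hs := step c
      rcases Nat.eq_zero_or_pos (c - i).val with h0 | hpos
      · obtain rfl : c = i := val_eq _ _ (by omega)
        have h12 := hχ 12
        have h13 := hχ 13
        rw [hXi, hXi, hXt (c + 1) _ (by omega) (by omega), hXt (c + 1) _ (by omega) (by omega)]
        change χ 4 ≠ χ 9 → m (c, 10) = 0 at h12
        change χ 7 ≠ χ 9 → m (c, 11) = 0 at h13
        rw [hχ9] at h12 h13
        exact ⟨h12, h13⟩
      rcases lt_trichotomy (c - i).val N with hlt | heq | hgt
      · rw [hXt c _ hpos.ne' hlt, hXt c _ hpos.ne' hlt]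
        by_cases h1 : (c + 1 - i).val < N
        · rw [hXt (c + 1) _ (by omega) h1, hXt (c + 1) _ (by omega) h1]
          simp
        · obtain rfl : c + 1 = j := val_eq _ _ (by omega)
          have h10 := hψ 10
          have h11 := hψ 11
          rw [hXj, hXj]
          change ψ 8 ≠ ψ 0 → m (c + 1 - 1, 10) = 0 at h10
          change ψ 8 ≠ ψ 3 → m (c + 1 - 1, 11) = 0 at h11
          rw [add_sub_cancel_right, hψ8] at h10 h11
          constructor
          · intro h
            apply h10
            change true ≠ !ψ 0 at h
            simpa using h
          · intro h
            apply h11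
            change true ≠ !ψ 3 at h
            simpa using h
      · obtain rfl : c = j := val_eq _ _ (by omega)
        have h12 := hψ 12
        have h13 := hψ 13
        rw [hXj, hXj, hXf (c + 1) _ (by omega), hXf (c + 1) _ (by omega)]
        change ψ 4 ≠ ψ 9 → m (c, 10) = 0 at h12
        change ψ 7 ≠ ψ 9 → m (c, 11) = 0 at h13
        rw [hψ9] at h12 h13
        constructor
        · intro h
          apply h12
          change (!ψ 4) ≠ false at h
          simpa using h
        · intro h
          apply h13
          change (!ψ 7) ≠ false at h
          simpa using h
      · rw [hXf c _ hgt, hXf c _ hgt]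
        rcases hs with ⟨hs1, hs2⟩ | ⟨hs1, hs2⟩
        · obtain rfl : c + 1 = i := val_eq _ _ (by omega)
          have h10 := hχ 10
          have h11 := hχ 11
          rw [hXi, hXi]
          change χ 8 ≠ χ 0 → m (c + 1 - 1, 10) = 0 at h10
          change χ 8 ≠ χ 3 → m (c + 1 - 1, 11) = 0 at h11
          rw [add_sub_cancel_right, hχ8] at h10 h11
          exact ⟨h10, h11⟩
        · rw [hXf (c + 1) _ (by omega), hXf (c + 1) _ (by omega)]
          simp
    rintro ⟨c, e⟩ he
    by_cases he10 : e < 10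
    · simp only [ringSrc, ringDst, if_pos he10] at he
      by_cases hci : c = i
      · subst hci
        rw [hXi, hXi] at he
        exact weight_eq_zero_of_cellWeight hχ e he10 he
      by_cases hcj : c = j
      · subst hcj
        rw [hXj, hXj] at he
        refine weight_eq_zero_of_cellWeight hψ e he10 fun h => he ?_
        rw [h]
      have h0 : (c - i).val ≠ 0 := fun h => hci (val_eq _ _ (by omega))
      have h1 : (c - i).val ≠ N := fun h => hcj (val_eq _ _ (by omega))
      exfalso
      rcases h1.lt_or_gt with h1 | h1
      · exact he (by rw [hXt c _ h0 h1, hXt c _ h0 h1])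
      · exact he (by rw [hXf c _ h1, hXf c _ h1])
    · obtain rfl | rfl : e = 10 ∨ e = 11 := by omega
      · exact (hlinks c).1 he
      · exact (hlinks c).2 he
  -- As `2 ≤ N ≤ K - 2`, the cells `i + 1` and `i - 1` lie on different arcs.
  have h1 := (hm X).2 hX0 (i + 1, 0) (i - 1, 0)
  have s1 := step i
  have s2 := step (i - 1)
  rw [sub_add_cancel] at s2
  have e1 : (i + 1 - i).val = 1 := by omega
  have e2 : (i - 1 - i).val = K - 1 := by omega
  simp only [X, e1, e2] at h1
  rw [if_neg (by omega), if_pos (by omega), if_neg (by omega), if_neg (by omega),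
    if_neg (by omega)] at h1
  simp at h1

/-- Every tour weight of the ring has total at least `9 * (K - 3)`. -/
theorem IsTourWeight.nine_mul_le [NeZero K] [Fact (1 < K)] {m₀ : ZMod K × Fin 12 → ℕ}
    (h₀ : IsTourWeight (ringSrc K) (ringDst K) m₀) : 9 * (K - 3) ≤ ∑ e, m₀ e := by
  obtain ⟨m, hm, hle, hred⟩ := h₀.exists_reduced (Finset.univ.filter fun e => 10 ≤ e.2)
  refine le_trans ?_ hle
  -- A link of weight at least 2 has weight exactly 2 and lies in a cut made of links only. Cells
  -- are connected, so this cut is constant on each cell; it thus contains the parallel link, which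
  -- has weight 0.
  have hlink : ∀ c, m (c, 10) + m (c, 11) ≤ 2 := by
    have cell : ∀ (χ : ZMod K × Fin 8 → Bool),
        (∀ f, χ (ringSrc K f) ≠ χ (ringDst K f) → 10 ≤ f.2) → ∀ c v, χ (c, v) = χ (c, 0) := by
      intro χ h c
      have h' : ∀ e, e < 10 → χ (c, cellSrc e) = χ (c, cellDst e) := by
        intro e he
        by_contra hne
        refine absurd (h (c, e) ?_) he.not_ge
        simpa only [ringSrc, ringDst, if_pos he] using hne
      have e0 : χ (c, 0) = χ (c, 1) := h' 0 (by decide)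
      have e1 : χ (c, 1) = χ (c, 2) := h' 1 (by decide)
      have e2 : χ (c, 2) = χ (c, 3) := h' 2 (by decide)
      have e3 : χ (c, 4) = χ (c, 5) := h' 3 (by decide)
      have e4 : χ (c, 5) = χ (c, 6) := h' 4 (by decide)
      have e5 : χ (c, 6) = χ (c, 7) := h' 5 (by decide)
      have e6 : χ (c, 0) = χ (c, 6) := h' 6 (by decide)
      intro v
      fin_cases v <;> simp_all
    have main : ∀ c : ZMod K, ∀ e f : Fin 12, 10 ≤ e → 10 ≤ f → f ≠ e → 2 ≤ m (c, e) →
        m (c, e) + m (c, f) ≤ 2 := by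
      intro c e f he hf hfe h2
      obtain ⟨h2', χ, hχ, hχf⟩ := hred (c, e) (by simpa using he) h2
      have hc := cell χ (fun g hg => by
        by_cases hge : g = (c, e)
        · rw [hge]
          exact he
        · simpa using (hχf g hge hg).2)
      have hf0 := (hχf (c, f) (by simpa using hfe) (by
        simp only [ringSrc, ringDst, if_neg he.not_gt, if_neg hf.not_gt] at hχ ⊢
        rwa [hc, hc (c + 1)] at hχ ⊢)).1
      omega
    intro c
    have h1 := main c 10 11 (by decide) (by decide) (by decide)
    have h2 := main c 11 10 (by decide) (by decide) (by decide)
    omega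
  have hnine : ∀ c, ¬ IsSeparated m c → 9 ≤ ∑ j, m (c, j) := fun c =>
    nine_le_of_not_isSeparated hm c (hlink _)
  obtain ⟨T, hT, hTsep⟩ : ∃ T : Finset (ZMod K), T.card ≤ 3 ∧ ∀ c, IsSeparated m c → c ∈ T := by
    by_cases h : ∃ i, IsSeparated m i
    · obtain ⟨i, hi⟩ := h
      exact ⟨{i, i + 1, i - 1}, Finset.card_le_three, fun j hj => hi.mem_of_isSeparated hm hj⟩
    · exact ⟨∅, by simp, fun c hc => absurd ⟨c, hc⟩ h⟩
  rw [Fintype.sum_prod_type]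
  calc 9 * (K - 3) ≤ Tᶜ.card * 9 := by
        rw [Finset.card_compl, ZMod.card]
        omega
    _ ≤ ∑ c ∈ Tᶜ, ∑ j, m (c, j) := by
        rw [← smul_eq_mul]
        refine Finset.card_nsmul_le_sum _ _ _ fun c hc => hnine c fun h => ?_
        exact (Finset.mem_compl.1 hc) (hTsep c h)
    _ ≤ ∑ c, ∑ j, m (c, j) :=
        Finset.sum_le_sum_of_subset (Finset.subset_univ _)

end Ring

/-! ### The ring graph: cubicity and colourings after deleting two vertices -/

section RingGraph

variable {K : ℕ}

/-- The ring of `K` cells, each a Petersen graph without two adjacent vertices. -/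
def petersenRing (K : ℕ) : SimpleGraph (ZMod K × Fin 8) where
  Adj x y := ∃ e, (ringSrc K e = x ∧ ringDst K e = y) ∨ (ringSrc K e = y ∧ ringDst K e = x)
  symm := ⟨fun _ _ ⟨e, he⟩ => ⟨e, he.symm⟩⟩
  loopless := ⟨by
    have h : ∀ e, cellSrc e ≠ cellDst e := by decide
    rintro x ⟨⟨c, e⟩, ⟨h1, h2⟩ | ⟨h1, h2⟩⟩ <;>
      exact h e (congrArg Prod.snd (h1.trans h2.symm))⟩

lemma petersenRing_adj (e : ZMod K × Fin 12) : (petersenRing K).Adj (ringSrc K e) (ringDst K e) :=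
  ⟨e, Or.inl ⟨rfl, rfl⟩⟩

lemma petersenRing_isRegularOfDegree [NeZero K] [DecidableRel (petersenRing K).Adj] :
    (petersenRing K).IsRegularOfDegree 3 := by
  rintro ⟨c, v⟩
  -- Distinct labels keep the three neighbours distinct even when `c - 1` and `c + 1` coincide.
  have key : ∃ x y z : ZMod K × Fin 8, x.2 ≠ y.2 ∧ x.2 ≠ z.2 ∧ y.2 ≠ z.2 ∧
      ∀ w, (petersenRing K).Adj (c, v) w ↔ w = x ∨ w = y ∨ w = z := by
    have hc : ∀ v : Fin 8, (c - 1 + 1, v) = (c, v) := fun v => by rw [sub_add_cancel]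
    fin_cases v
    · refine ⟨(c, 1), (c, 6), (c - 1, 4), by simp, by simp, by simp, fun w => ⟨?_, ?_⟩⟩
      · obtain ⟨c', v'⟩ := w
        rintro ⟨⟨d, e⟩, h⟩
        simp only [ringSrc, ringDst, Prod.mk.injEq] at h
        fin_cases e <;> simp [cellSrc, cellDst] at h ⊢ <;> grind
      rintro (rfl | rfl | rfl)
      exacts [⟨(c, 0), Or.inl ⟨rfl, rfl⟩⟩,
        ⟨(c, 6), Or.inl ⟨rfl, rfl⟩⟩,
        ⟨(c - 1, 10), Or.inr ⟨rfl, hc _⟩⟩]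
    · refine ⟨(c, 0), (c, 2), (c, 4), by simp, by simp, by simp, fun w => ⟨?_, ?_⟩⟩
      · obtain ⟨c', v'⟩ := w
        rintro ⟨⟨d, e⟩, h⟩
        simp only [ringSrc, ringDst, Prod.mk.injEq] at h
        fin_cases e <;> simp [cellSrc, cellDst] at h ⊢ <;> grind
      rintro (rfl | rfl | rfl)
      exacts [⟨(c, 0), Or.inr ⟨rfl, rfl⟩⟩,
        ⟨(c, 1), Or.inl ⟨rfl, rfl⟩⟩,
        ⟨(c, 7), Or.inl ⟨rfl, rfl⟩⟩]
    · refine ⟨(c, 1), (c, 3), (c, 7), by simp, by simp, by simp, fun w => ⟨?_, ?_⟩⟩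
      · obtain ⟨c', v'⟩ := w
        rintro ⟨⟨d, e⟩, h⟩
        simp only [ringSrc, ringDst, Prod.mk.injEq] at h
        fin_cases e <;> simp [cellSrc, cellDst] at h ⊢ <;> grind
      rintro (rfl | rfl | rfl)
      exacts [⟨(c, 1), Or.inr ⟨rfl, rfl⟩⟩,
        ⟨(c, 2), Or.inl ⟨rfl, rfl⟩⟩,
        ⟨(c, 8), Or.inl ⟨rfl, rfl⟩⟩]
    · refine ⟨(c, 2), (c, 5), (c - 1, 7), by simp, by simp, by simp, fun w => ⟨?_, ?_⟩⟩
      · obtain ⟨c', v'⟩ := w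
        rintro ⟨⟨d, e⟩, h⟩
        simp only [ringSrc, ringDst, Prod.mk.injEq] at h
        fin_cases e <;> simp [cellSrc, cellDst] at h ⊢ <;> grind
      rintro (rfl | rfl | rfl)
      exacts [⟨(c, 2), Or.inr ⟨rfl, rfl⟩⟩,
        ⟨(c, 9), Or.inl ⟨rfl, rfl⟩⟩,
        ⟨(c - 1, 11), Or.inr ⟨rfl, hc _⟩⟩]
    · refine ⟨(c, 5), (c, 1), (c + 1, 0), by simp, by simp, by simp, fun w => ⟨?_, ?_⟩⟩
      · obtain ⟨c', v'⟩ := w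
        rintro ⟨⟨d, e⟩, h⟩
        simp only [ringSrc, ringDst, Prod.mk.injEq] at h
        fin_cases e <;> simp [cellSrc, cellDst] at h ⊢ <;> grind
      rintro (rfl | rfl | rfl)
      exacts [⟨(c, 3), Or.inl ⟨rfl, rfl⟩⟩,
        ⟨(c, 7), Or.inr ⟨rfl, rfl⟩⟩,
        ⟨(c, 10), Or.inl ⟨rfl, rfl⟩⟩]
    · refine ⟨(c, 4), (c, 6), (c, 3), by simp, by simp, by simp, fun w => ⟨?_, ?_⟩⟩
      · obtain ⟨c', v'⟩ := w
        rintro ⟨⟨d, e⟩, h⟩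
        simp only [ringSrc, ringDst, Prod.mk.injEq] at h
        fin_cases e <;> simp [cellSrc, cellDst] at h ⊢ <;> grind
      rintro (rfl | rfl | rfl)
      exacts [⟨(c, 3), Or.inr ⟨rfl, rfl⟩⟩,
        ⟨(c, 4), Or.inl ⟨rfl, rfl⟩⟩,
        ⟨(c, 9), Or.inr ⟨rfl, rfl⟩⟩]
    · refine ⟨(c, 5), (c, 7), (c, 0), by simp, by simp, by simp, fun w => ⟨?_, ?_⟩⟩
      · obtain ⟨c', v'⟩ := w
        rintro ⟨⟨d, e⟩, h⟩
        simp only [ringSrc, ringDst, Prod.mk.injEq] at h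
        fin_cases e <;> simp [cellSrc, cellDst] at h ⊢ <;> grind
      rintro (rfl | rfl | rfl)
      exacts [⟨(c, 4), Or.inr ⟨rfl, rfl⟩⟩,
        ⟨(c, 5), Or.inl ⟨rfl, rfl⟩⟩,
        ⟨(c, 6), Or.inr ⟨rfl, rfl⟩⟩]
    · refine ⟨(c, 6), (c, 2), (c + 1, 3), by simp, by simp, by simp, fun w => ⟨?_, ?_⟩⟩
      · obtain ⟨c', v'⟩ := w
        rintro ⟨⟨d, e⟩, h⟩
        simp only [ringSrc, ringDst, Prod.mk.injEq] at h
        fin_cases e <;> simp [cellSrc, cellDst] at h ⊢ <;> grind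
      rintro (rfl | rfl | rfl)
      exacts [⟨(c, 5), Or.inr ⟨rfl, rfl⟩⟩,
        ⟨(c, 8), Or.inr ⟨rfl, rfl⟩⟩,
        ⟨(c, 11), Or.inl ⟨rfl, rfl⟩⟩]
  obtain ⟨x, y, z, hxy, hxz, hyz, h⟩ := key
  rw [← SimpleGraph.card_neighborFinset_eq_degree, Finset.card_eq_three]
  refine ⟨x, y, z, fun h => hxy (h ▸ rfl), fun h => hxz (h ▸ rfl), fun h => hyz (h ▸ rfl), ?_⟩
  ext w
  simp [h]

/-- A cell stays connected when one vertex is deleted. -/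
lemma cell_colouring_eq_of_one {f : Fin 8 → Bool} {r : Fin 8}
    (hf : ∀ e < 10, cellSrc e ≠ r → cellDst e ≠ r → f (cellSrc e) = f (cellDst e)) :
    ∃ b, ∀ v, v ≠ r → f v = b := by
  have e0 : 0 ≠ r → 1 ≠ r → f 0 = f 1 := hf 0 (by decide)
  have e1 : 1 ≠ r → 2 ≠ r → f 1 = f 2 := hf 1 (by decide)
  have e2 : 2 ≠ r → 3 ≠ r → f 2 = f 3 := hf 2 (by decide)
  have e3 : 4 ≠ r → 5 ≠ r → f 4 = f 5 := hf 3 (by decide)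
  have e4 : 5 ≠ r → 6 ≠ r → f 5 = f 6 := hf 4 (by decide)
  have e5 : 6 ≠ r → 7 ≠ r → f 6 = f 7 := hf 5 (by decide)
  have e6 : 0 ≠ r → 6 ≠ r → f 0 = f 6 := hf 6 (by decide)
  have e7 : 1 ≠ r → 4 ≠ r → f 1 = f 4 := hf 7 (by decide)
  have e8 : 2 ≠ r → 7 ≠ r → f 2 = f 7 := hf 8 (by decide)
  have e9 : 3 ≠ r → 5 ≠ r → f 3 = f 5 := hf 9 (by decide)
  clear hf
  refine ⟨if r = 0 then f 1 else f 0, fun v hv => ?_⟩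
  have z : ∀ k : Fin 8, k = 0 ∨ k = 1 ∨ k = 2 ∨ k = 3 ∨ k = 4 ∨ k = 5 ∨ k = 6 ∨ k = 7 := by decide
  rcases z r with rfl | rfl | rfl | rfl | rfl | rfl | rfl | rfl <;>
    simp +decide only [forall_const, false_implies, if_true, if_false] at e0 e1 e2 e3 e4 e5 e6 e7 e8 e9 ⊢ <;>
    rcases z v with rfl | rfl | rfl | rfl | rfl | rfl | rfl | rfl <;>
    first
    | exact absurd rfl hv
    | grind

/-- After deleting two vertices a cell may fall apart, but each component still contains one of the
vertices `0`, `3`, `4`, `7` that carry links. Each of `1`, `2`, `5`, `6` has two such neighbours; if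
both are deleted, a path of length two leads to another. -/
lemma cell_colouring_eq_of_two {f : Fin 8 → Bool} {p : Fin 8 → Prop} {b : Bool}
    (hp : ∃ r r', ∀ v, v ≠ r → v ≠ r' → p v)
    (hf : ∀ e < 10, p (cellSrc e) → p (cellDst e) → f (cellSrc e) = f (cellDst e))
    (h0 : p 0 → f 0 = b) (h3 : p 3 → f 3 = b) (h4 : p 4 → f 4 = b) (h7 : p 7 → f 7 = b)
    (v : Fin 8) (hv : p v) : f v = b := by
  have e0 : p 0 → p 1 → f 0 = f 1 := hf 0 (by decide)
  have e1 : p 1 → p 2 → f 1 = f 2 := hf 1 (by decide)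
  have e2 : p 2 → p 3 → f 2 = f 3 := hf 2 (by decide)
  have e3 : p 4 → p 5 → f 4 = f 5 := hf 3 (by decide)
  have e4 : p 5 → p 6 → f 5 = f 6 := hf 4 (by decide)
  have e5 : p 6 → p 7 → f 6 = f 7 := hf 5 (by decide)
  have e6 : p 0 → p 6 → f 0 = f 6 := hf 6 (by decide)
  have e7 : p 1 → p 4 → f 1 = f 4 := hf 7 (by decide)
  have e8 : p 2 → p 7 → f 2 = f 7 := hf 8 (by decide)
  have e9 : p 3 → p 5 → f 3 = f 5 := hf 9 (by decide)
  obtain ⟨r, r', hr⟩ := hp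
  have three : ∀ x y z : Fin 8, x ≠ y → x ≠ z → y ≠ z → p x ∨ p y ∨ p z := by
    intro x y z hxy hxz hyz
    by_contra! h
    have hx := mt (hr x)
    have hy := mt (hr y)
    have hz := mt (hr z)
    grind
  have t1 := three 0 4 2 (by decide) (by decide) (by decide)
  have t1' := three 0 4 3 (by decide) (by decide) (by decide)
  have t2 := three 3 7 1 (by decide) (by decide) (by decide)
  have t2' := three 3 7 0 (by decide) (by decide) (by decide)
  have t5 := three 4 3 6 (by decide) (by decide) (by decide)
  have t5' := three 4 3 7 (by decide) (by decide) (by decide)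
  have t6 := three 7 0 5 (by decide) (by decide) (by decide)
  have t6' := three 7 0 4 (by decide) (by decide) (by decide)
  clear three hr hf
  fin_cases v
  · exact h0 hv
  · change p 1 at hv; change f 1 = b; grind
  · change p 2 at hv; change f 2 = b; grind
  · exact h3 hv
  · exact h4 hv
  · change p 5 at hv; change f 5 = b; grind
  · change p 6 at hv; change f 6 = b; grind
  · exact h7 hv

/-- Breaking the ring between `l` and `l + 1` leaves a path through all cells. -/
lemma eq_of_eq_add_one {α : Type*} [NeZero K] {g : ZMod K → α} {l : ZMod K}
    (h : ∀ c, c ≠ l → g c = g (c + 1)) (c : ZMod K) : g c = g (l + 1) := by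
  have key : ∀ n : ℕ, n < K → g (l + 1 + n) = g (l + 1) := by
    intro n
    induction n with
    | zero => simp
    | succ n ih =>
      intro hn
      rw [← ih (by omega), h (l + 1 + n), Nat.cast_succ, ← add_assoc]
      intro heq
      have h0 : ((n + 1 : ℕ) : ZMod K) = 0 := by
        rw [add_assoc, add_eq_left] at heq
        push_cast
        rw [add_comm, heq]
      rw [ZMod.natCast_eq_zero_iff] at h0
      exact absurd (Nat.le_of_dvd (Nat.succ_pos n) h0) (by omega)
  have h1 := key (c - (l + 1)).val (ZMod.val_lt _)
  rwa [ZMod.natCast_zmod_val, add_sub_cancel] at h1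

/-- A colouring of the ring without two vertices that is constant along edges is constant. -/
lemma ring_colouring_eq [NeZero K] [Fact (1 < K)] {F : ZMod K × Fin 8 → Bool}
    {x y : ZMod K × Fin 8}
    (hF : ∀ u v, u ≠ x → u ≠ y → v ≠ x → v ≠ y → (petersenRing K).Adj u v → F u = F v)
    (u v : ZMod K × Fin 8) (hux : u ≠ x) (huy : u ≠ y) (hvx : v ≠ x) (hvy : v ≠ y) :
    F u = F v := by
  have hin : ∀ c e, e < 10 → (petersenRing K).Adj (c, cellSrc e) (c, cellDst e) := by
    intro c e he
    have := petersenRing_adj (c, e)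
    simpa only [ringSrc, ringDst, if_pos he] using this
  have hl0 : ∀ c, (petersenRing K).Adj (c, 4) (c + 1, 0) := fun c => petersenRing_adj (c, 10)
  have hl3 : ∀ c, (petersenRing K).Adj (c, 7) (c + 1, 3) := fun c => petersenRing_adj (c, 11)
  suffices h : ∃ b, ∀ u, u ≠ x → u ≠ y → F u = b by
    obtain ⟨b, hb⟩ := h
    rw [hb u hux huy, hb v hvx hvy]
  obtain ⟨i, r⟩ := x
  obtain ⟨j, r'⟩ := y
  by_cases hij : i = j
  · subst hij
    have hcell : ∀ c, c ≠ i → ∀ v, F (c, v) = F (c, 0) := by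
      intro c hc
      have hne : ∀ v r : Fin 8, (c, v) ≠ (i, r) := fun v r h => hc (congrArg Prod.fst h)
      have h1 : ∀ r, ∃ b, ∀ v, v ≠ r → F (c, v) = b := fun r =>
        cell_colouring_eq_of_one fun e he _ _ =>
          hF _ _ (hne _ _) (hne _ _) (hne _ _) (hne _ _) (hin c e he)
      intro v
      obtain ⟨s, hs0, hsv⟩ : ∃ s : Fin 8, 0 ≠ s ∧ v ≠ s := by revert v; decide
      obtain ⟨b, hb⟩ := h1 s
      rw [hb v hsv, hb 0 hs0]
    have hne : ∀ c, c ≠ i → ∀ v r : Fin 8, (c, v) ≠ (i, r) := fun c hc v r h =>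
      hc (congrArg Prod.fst h)
    have hi1 : i + 1 ≠ i := by simp
    have hi2 : i - 1 ≠ i := by simp
    -- Both deleted vertices lie in cell `i`. The other cells form an intact path; giving cell `i`
    -- the colour of its successor reduces this to a ring broken at `i - 1`.
    have hg := eq_of_eq_add_one (g := fun c => if c = i then F (i + 1, 0) else F (c, 0))
      (l := i - 1) (by
        intro c hc
        have hc' : c + 1 ≠ i := fun h => hc (by rw [← h]; ring)
        by_cases hci : c = i
        · subst hci
          simp
        · simp only [if_neg hci, if_neg hc']
          rw [← hcell c hci 4]
          exact hF _ _ (hne c hci _ _) (hne c hci _ _) (hne _ hc' _ _) (hne _ hc' _ _) (hl0 c))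
    simp only [sub_add_cancel, if_true] at hg
    have hout : ∀ c, c ≠ i → ∀ v, F (c, v) = F (i + 1, 0) := by
      intro c hc v
      rw [hcell c hc v, ← hg c, if_neg hc]
    refine ⟨F (i + 1, 0), ?_⟩
    rintro ⟨c, v⟩ h1 h2
    by_cases hc : c = i
    · subst hc
      refine cell_colouring_eq_of_two (f := fun v => F (c, v))
        (p := fun v => (c, v) ≠ (c, r) ∧ (c, v) ≠ (c, r')) ⟨r, r', ?_⟩ ?_ ?_ ?_ ?_ ?_ v ⟨h1, h2⟩
      · intro v hv hv'
        simp [hv, hv']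
      · intro e he hs ht
        exact hF _ _ hs.1 hs.2 ht.1 ht.2 (hin c e he)
      · intro hv
        have := hl0 (c - 1)
        rw [sub_add_cancel] at this
        rw [← hout _ hi2 4]
        exact (hF _ _ (hne _ hi2 _ _) (hne _ hi2 _ _) hv.1 hv.2 this).symm
      · intro hv
        have := hl3 (c - 1)
        rw [sub_add_cancel] at this
        rw [← hout _ hi2 7]
        exact (hF _ _ (hne _ hi2 _ _) (hne _ hi2 _ _) hv.1 hv.2 this).symm
      · intro hv
        exact hF _ _ hv.1 hv.2 (hne _ hi1 _ _) (hne _ hi1 _ _) (hl0 c)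
      · intro hv
        rw [← hout _ hi1 3]
        exact hF _ _ hv.1 hv.2 (hne _ hi1 _ _) (hne _ hi1 _ _) (hl3 c)
    · exact hout c hc v
  · have hcell : ∀ c, ∃ b, ∀ v, (c, v) ≠ (i, r) → (c, v) ≠ (j, r') → F (c, v) = b := by
      intro c
      by_cases hci : c = i
      · subst hci
        obtain ⟨b, hb⟩ := cell_colouring_eq_of_one (f := fun v => F (c, v)) (r := r)
          (fun e he hs ht => hF _ _ (by simpa using hs) (by simp [hij]) (by simpa using ht)
            (by simp [hij]) (hin c e he))
        exact ⟨b, fun v hv _ => hb v (by simpa using hv)⟩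
      · by_cases hcj : c = j
        · subst hcj
          obtain ⟨b, hb⟩ := cell_colouring_eq_of_one (f := fun v => F (c, v)) (r := r')
            (fun e he hs ht => hF _ _ (by simp [hci]) (by simpa using hs) (by simp [hci])
              (by simpa using ht) (hin c e he))
          exact ⟨b, fun v _ hv => hb v (by simpa using hv)⟩
        · have h1 : ∀ r, ∃ b, ∀ v, v ≠ r → F (c, v) = b := fun r =>
            cell_colouring_eq_of_one fun e he _ _ =>
              hF _ _ (by simp [hci]) (by simp [hcj]) (by simp [hci]) (by simp [hcj]) (hin c e he)
          refine ⟨F (c, 0), fun v _ _ => ?_⟩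
          obtain ⟨s, hs0, hsv⟩ : ∃ s : Fin 8, 0 ≠ s ∧ v ≠ s := by
            clear * - v
            revert v
            decide
          obtain ⟨b, hb⟩ := h1 s
          rw [hb v hsv, hb 0 hs0]
    choose g hg using hcell
    -- Consecutive cells are joined by two disjoint links. The vertex `x` can meet links at the
    -- break `l` only, and elsewhere the other deleted vertex destroys at most one link of the two.
    have hgl := eq_of_eq_add_one (g := g) (l := if r = 4 ∨ r = 7 then i else i - 1) (by
      intro c hc
      by_contra hne
      have b0 : ((c, 4) = (i, r) ∨ (c + 1, 0) = (i, r)) ∨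
          ((c, 4) = (j, r') ∨ (c + 1, 0) = (j, r')) := by
        by_contra! h
        apply hne
        rw [← hg c 4 h.1.1 h.2.1, ← hg (c + 1) 0 h.1.2 h.2.2]
        exact hF _ _ h.1.1 h.2.1 h.1.2 h.2.2 (hl0 c)
      have b3 : ((c, 7) = (i, r) ∨ (c + 1, 3) = (i, r)) ∨
          ((c, 7) = (j, r') ∨ (c + 1, 3) = (j, r')) := by
        by_contra! h
        apply hne
        rw [← hg c 7 h.1.1 h.2.1, ← hg (c + 1) 3 h.1.2 h.2.2]
        exact hF _ _ h.1.1 h.2.1 h.1.2 h.2.2 (hl3 c)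
      simp only [Prod.mk.injEq] at b0 b3
      have hlx : ¬ (((c, 4) = (i, r) ∨ (c + 1, 0) = (i, r)) ∨
          ((c, 7) = (i, r) ∨ (c + 1, 3) = (i, r))) := by
        simp only [Prod.mk.injEq]
        rintro ((⟨rfl, rfl⟩ | ⟨rfl, rfl⟩) | (⟨rfl, rfl⟩ | ⟨rfl, rfl⟩)) <;> simp at hc
      simp only [Prod.mk.injEq, not_or] at hlx
      have c0 := b0.resolve_left (by simpa only [not_or] using hlx.1)
      have c3 := b3.resolve_left (by simpa only [not_or] using hlx.2)
      rcases c0 with ⟨_, h⟩ | ⟨_, h⟩ <;> rcases c3 with ⟨_, h'⟩ | ⟨_, h'⟩ <;>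
        rw [← h] at h' <;> exact absurd h' (by decide))
    exact ⟨_, fun u h1 h2 => (hg u.1 u.2 h1 h2).trans (hgl u.1)⟩

end RingGraph

/-! ### 3-connectivity, existence of tours and the bound on `tsp` -/

section Tours

/-- In a finite connected graph some closed walk contains all vertices. -/
lemma exists_isTSPTour {V : Type*} [Fintype V] {G : SimpleGraph V} (hG : G.Connected) :
    ∃ (v : V) (w : G.Walk v v), G.IsTSPTour w := by
  classical
  obtain ⟨v⟩ := hG.nonempty
  have key : ∀ T : Finset V, ∃ w : G.Walk v v, ∀ u ∈ T, u ∈ w.support := by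
    intro T
    induction T using Finset.induction_on with
    | empty => exact ⟨SimpleGraph.Walk.nil, by simp⟩
    | insert a T _ ih =>
      obtain ⟨w, hw⟩ := ih
      obtain ⟨p⟩ := hG.preconnected v a
      refine ⟨(p.append p.reverse).append w, fun u hu => ?_⟩
      rw [SimpleGraph.Walk.mem_support_append_iff, SimpleGraph.Walk.mem_support_append_iff]
      rcases Finset.mem_insert.1 hu with rfl | hu
      · exact Or.inl (Or.inl p.end_mem_support)
      · exact Or.inr (hw u hu)
  obtain ⟨w, hw⟩ := key Finset.univ
  exact ⟨v, w, fun u => hw u (Finset.mem_univ u)⟩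

variable {K : ℕ}

lemma petersenRing_isVertexConnected [NeZero K] [Fact (1 < K)] :
    (petersenRing K).IsVertexConnected 3 := by
  have hK : 1 < K := Fact.out
  have hcard : Fintype.card (ZMod K × Fin 8) = K * 8 := by simp [ZMod.card]
  refine ⟨by omega, fun S hS => ?_⟩
  classical
  obtain ⟨z, hz⟩ : ∃ z, z ∉ S := by
    by_contra! h
    have := Finset.card_le_card (fun x _ => h x : (Finset.univ : Finset (ZMod K × Fin 8)) ⊆ S)
    rw [Finset.card_univ] at this
    omega
  refine (SimpleGraph.connected_iff _).2 ⟨fun a b => ?_, ⟨⟨z, hz⟩⟩⟩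
  -- `S` is enlarged to exactly two vertices, avoiding `a` and `b`, to fit the colouring lemma.
  obtain ⟨S', hSS', hS'ab, hS'card⟩ : ∃ S' : Finset (ZMod K × Fin 8),
      S ⊆ S' ∧ S' ⊆ {a.1, b.1}ᶜ ∧ S'.card = 2 := by
    refine Finset.exists_subsuperset_card_eq (fun x hx => ?_) (by omega) ?_
    · simp only [Finset.mem_compl, Finset.mem_insert, Finset.mem_singleton, not_or]
      exact ⟨fun h => a.2 (h ▸ hx), fun h => b.2 (h ▸ hx)⟩
    · have := Finset.card_le_two (a := a.1) (b := b.1)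
      rw [Finset.card_compl]
      omega
  obtain ⟨x, y, _, rfl⟩ := Finset.card_eq_two.1 hS'card
  -- The colouring marks the component of `a` in the graph without `S`.
  let F : ZMod K × Fin 8 → Bool := fun v => decide (∃ h : v ∉ S,
    ((petersenRing K).induce {v | v ∉ S}).Reachable a ⟨v, h⟩)
  have hF : F a.1 = F b.1 := by
    have hne : ∀ v, v ∈ ({a.1, b.1} : Finset (ZMod K × Fin 8)) → v ≠ x ∧ v ≠ y := by
      intro v hv
      refine ⟨?_, ?_⟩ <;> rintro rfl <;> exact Finset.mem_compl.1 (hS'ab (by simp)) hv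
    refine ring_colouring_eq (x := x) (y := y) (fun u v hux huy hvx hvy huv => ?_) _ _
      (hne _ (by simp)).1 (hne _ (by simp)).2 (hne _ (by simp)).1 (hne _ (by simp)).2
    have hu : u ∉ S := fun h => by simpa [hux, huy] using hSS' h
    have hv : v ∉ S := fun h => by simpa [hvx, hvy] using hSS' h
    have hadj : ((petersenRing K).induce {v | v ∉ S}).Adj ⟨u, hu⟩ ⟨v, hv⟩ := huv
    simp only [F, decide_eq_decide]
    exact ⟨fun ⟨_, h⟩ => ⟨hv, h.trans hadj.reachable⟩,
      fun ⟨_, h⟩ => ⟨hu, h.trans hadj.symm.reachable⟩⟩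
  have hFa : F a.1 = true := by
    simp only [F, decide_eq_true_eq]
    exact ⟨a.2, SimpleGraph.Reachable.refl _⟩
  rw [hF] at hFa
  simp only [F, decide_eq_true_eq] at hFa
  exact hFa.2

lemma SimpleGraph.IsVertexConnected.connected {V : Type*} [Fintype V] {G : SimpleGraph V} {k : ℕ}
    (h : G.IsVertexConnected k) (hk : 0 < k) : G.Connected := by
  have h1 := h.2 ∅ (by simpa using hk)
  have h2 : {v : V | v ∉ (∅ : Finset V)} = Set.univ := by
    ext
    simp
  rw [h2] at h1
  exact G.induceUnivIso.connected_iff.1 h1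

lemma nine_mul_le_tsp_petersenRing [NeZero K] [Fact (1 < K)] :
    9 * (K - 3) ≤ (petersenRing K).tsp := by
  -- A tour must exist, since the infimum of the empty set would be 0; then `tsp` is attained.
  obtain ⟨v₀, w₀, hw₀⟩ := exists_isTSPTour
    ((petersenRing_isVertexConnected (K := K)).connected (by decide))
  have hmem : (petersenRing K).tsp ∈ {l : ℕ | ∃ (v : ZMod K × Fin 8)
      (w : (petersenRing K).Walk v v), (petersenRing K).IsTSPTour w ∧ w.length = l} :=
    Nat.sInf_mem ⟨_, v₀, w₀, hw₀, rfl⟩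
  obtain ⟨v, w, hw, hl⟩ := hmem
  obtain ⟨m, hm, htour⟩ := exists_isTourWeight_of_isTSPTour
    (s := ringSrc K) (t := ringDst K) (fun x y h => h) hw
  rw [← hl, ← hm]
  exact htour.nine_mul_le

end Tours

theorem theorem3 (ε : ℝ) (hε : 0 < ε) :
    ∃ (V : Type) (_ : Fintype V) (G : SimpleGraph V) (_ : DecidableRel G.Adj),
      G.IsVertexConnected 3 ∧
      G.IsRegularOfDegree 3 ∧
      (1.125 - ε) * (Fintype.card V : ℝ) ≤ (G.tsp : ℝ) := by
  -- With `K = N + 3` the claim is `(9/8 - ε) * 8 * (N + 3) ≤ 9 * N`, that is `27 ≤ 8 * ε * (N +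
  -- 3)`.
  obtain ⟨N, hN⟩ := exists_nat_gt (27 / (8 * ε))
  have hNK : NeZero (N + 3) := ⟨by omega⟩
  have hfact : Fact (1 < N + 3) := ⟨by omega⟩
  classical
  refine ⟨ZMod (N + 3) × Fin 8, inferInstance, petersenRing (N + 3), inferInstance,
    petersenRing_isVertexConnected, petersenRing_isRegularOfDegree, ?_⟩
  have h1 : (9 * N : ℝ) ≤ ((petersenRing (N + 3)).tsp : ℝ) := by
    exact_mod_cast nine_mul_le_tsp_petersenRing (K := N + 3)
  have h2 : (Fintype.card (ZMod (N + 3) × Fin 8) : ℝ) = (N + 3) * 8 := by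
    rw [Fintype.card_prod, ZMod.card, Fintype.card_fin]
    push_cast
    ring
  rw [h2]
  refine le_trans ?_ h1
  rw [div_lt_iff₀ (by positivity)] at hN
  nlinarith
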